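/- Let $(P_n)_{n\ge1}$ be i.i.d. random variables with values in $[0,1]$, and let $H$ be the law of $P_1$. Define $A_{n,0}=0$ and $A_{n,n+1}=1$ for $n\ge0$, and for $n\ge1$ $$A_{n,k}=P_nA_{n-1,k-1}+(1-P_n)A_{n-1,k},\qquad k=1,\dots,n,$$ (the break points of the random stratified fragmentation) and set $\tilde G_n=\frac1n\sum_{k=1}^n\delta_{A_{n,k}^{1/n}}$, a random probability measure on $[0,1]$. Assume that $H(\{0,1\})<1$, and put $$\bar p=\int_0^1 t\,H(dt),\qquad h=H(\{1\}).$$ Then $h<\bar p<1$, and for every $\alpha\in(h,\bar p]$ there is a unique $\theta=\theta(\alpha)\in\mathbb R$ with $$\int_0^1\frac{te^{\theta}}{1-t+te^{\theta}}\,H(dt)=\alpha .$$ The function $$I(\alpha)=\alpha\,\theta(\alpha)-\int_0^1\log\bigl(1-t+te^{\theta(\alpha)}\bigr)H(dt),\qquad \alpha\in(h,\bar p],$$ is continuous and strictly decreasing, with $I(\bar p)=0$. Put $I(h)=\lim_{\alpha\downarrow h}I(\alpha)\in(0,\infty]$, which exists, and $x_*=e^{-I(h)}\in[0,1)$. For every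 $x\in[x_*,1]$ the equation $I(\alpha)=\log(1/x)$ has a unique solution $\alpha=\alpha_I(x)\in[h,\bar p]$. There is a probability measure $\tilde g$ on $[0,1]$ with $$\tilde g([0,x])=\begin{cases}h,&x\in[0,x_*],\\ \alpha_I(x),&x\in(x_*,1),\end{cases}$$ and, almost surely, $\tilde G_n\Rightarrow\tilde g$ weakly on $[0,1]$ as $n\to\infty$. (If $H(\{1\})=0$, then $h=0$, so $\tilde g([0,x])=0$ for $x\le x_*$.) -/

import Mathlib

open MeasureTheory ProbabilityTheory Filter Topology

noncomputable section

namespace FragErasure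

/-- The break points `a_{n,k}` (`0 ≤ k ≤ n + 1`) of the fragmentation with erasure with splitting
proportions `p n k` (`n ≥ 1`, `1 ≤ k ≤ n`): `a_{n,0} = 0`, `a_{n,n+1} = 1` and
`a_{n,k} = p_{n,k} a_{n-1,k-1} + (1 - p_{n,k}) a_{n-1,k}` for `1 ≤ k ≤ n`.
The value for `k > n + 1` is irrelevant (it is set to `1`). -/
def breakPoint (p : ℕ → ℕ → unitInterval) : ℕ → ℕ → ℝ
  | 0, 0 => 0
  | 0, _ + 1 => 1
  | _ + 1, 0 => 0
  | n + 1, k + 1 =>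
      if k ≤ n then
        (p (n + 1) (k + 1) : ℝ) * breakPoint p n k
          + (1 - (p (n + 1) (k + 1) : ℝ)) * breakPoint p n (k + 1)
      else 1

theorem breakPoint_mem (p : ℕ → ℕ → unitInterval) (n k : ℕ) :
    breakPoint p n k ∈ Set.Icc (0 : ℝ) 1 := by
  induction n generalizing k with
  | zero => cases k <;> simp [breakPoint]
  | succ n ih =>
    cases k with
    | zero => simp [breakPoint]
    | succ k =>
      unfold breakPoint
      split_ifs
      · exact convex_Icc (0 : ℝ) 1 (ih k) (ih (k + 1)) (p (n + 1) (k + 1)).2.1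
          (sub_nonneg.2 (p (n + 1) (k + 1)).2.2) (by ring)
      · simp

/-- The transformed break points `a_{n,k}^{1/n}`, as points of `[0,1]`. -/
def rootBreakPoint (p : ℕ → ℕ → unitInterval) (n k : ℕ) : unitInterval :=
  ⟨breakPoint p n k ^ (1 / (n : ℝ)),
    Real.rpow_nonneg (breakPoint_mem p n k).1 _,
    Real.rpow_le_one (breakPoint_mem p n k).1 (breakPoint_mem p n k).2 (by positivity)⟩

/-- The transformed empirical distribution `(1/n) ∑_{k=1}^n δ_{a_{n,k}^{1/n}}` on `[0,1]`
(the zero measure for `n = 0`). -/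
def gTildeMeasure (p : ℕ → ℕ → unitInterval) (n : ℕ) : Measure unitInterval :=
  (n : ENNReal)⁻¹ • ∑ k ∈ Finset.Icc 1 n, Measure.dirac (rootBreakPoint p n k)

instance (p : ℕ → ℕ → unitInterval) (n : ℕ) : IsFiniteMeasure (gTildeMeasure p n) := by
  refine ⟨?_⟩
  rcases Nat.eq_zero_or_pos n with rfl | hn
  · simp [gTildeMeasure]
  · have h0 : (n : ENNReal) ≠ 0 := by exact_mod_cast hn.ne'
    simp [gTildeMeasure, ENNReal.inv_mul_cancel h0]

/-- The same distribution as an element of the space of finite measures on `[0,1]`, which Mathlib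
equips with the topology of weak convergence. -/
def gTilde (p : ℕ → ℕ → unitInterval) (n : ℕ) : FiniteMeasure unitInterval :=
  ⟨gTildeMeasure p n, inferInstance⟩

/-- Stratified splitting proportions: `p_{n,k} = p_n` for all `k`. -/
def stratified (p : ℕ → unitInterval) : ℕ → ℕ → unitInterval := fun n _ => p n

/-- The mean `∫ t H(dt)`. -/
def pBar (H : Measure unitInterval) : ℝ := ∫ t, (t : ℝ) ∂H

/-- The mass `H({1})`. -/
def massOne (H : Measure unitInterval) : ℝ := H.real {1}

/-- `∫ t e^θ / (1 - t + t e^θ) H(dt)`. -/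
def tiltedMean (H : Measure unitInterval) (θ : ℝ) : ℝ :=
  ∫ t, ((t : ℝ) * Real.exp θ) / (1 - (t : ℝ) + (t : ℝ) * Real.exp θ) ∂H

/-- The solution `θ = θ(α)` of `∫ t e^θ / (1 - t + t e^θ) H(dt) = α`. -/
def theta (H : Measure unitInterval) (α : ℝ) : ℝ :=
  Classical.epsilon fun θ : ℝ => tiltedMean H θ = α

/-- `I(α) = α θ(α) - ∫ log (1 - t + t e^{θ(α)}) H(dt)`, for `H({1}) < α ≤ pBar H`. -/
def rate (H : Measure unitInterval) (α : ℝ) : ℝ :=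
  α * theta H α - ∫ t, Real.log (1 - (t : ℝ) + (t : ℝ) * Real.exp (theta H α)) ∂H

/-- The limit of `I(α)` as `α` decreases to `H({1})`, in the extended reals. When `H({1}) = 0`
this is `I(0) = lim_{α → 0+} I(α)`. -/
def rateLeft (H : Measure unitInterval) : EReal :=
  limUnder (𝓝[>] massOne H) fun α => (rate H α : EReal)

/-- The function `I` extended to its left end point `H({1})` by its limit there. -/
def rateExt (H : Measure unitInterval) (α : ℝ) : EReal :=
  if α = massOne H then rateLeft H else (rate H α : EReal)

/-- `x_* = exp (- I(H({1})))`, with `exp (-∞) = 0`. -/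
def xStar (H : Measure unitInterval) : ℝ := (EReal.exp (-rateLeft H)).toReal

/-- `α` solves `I(α) = log (1/x)` in `[H({1}), pBar H]`, with `log (1/0) = ∞`. -/
def SolvesRate (H : Measure unitInterval) (x α : ℝ) : Prop :=
  α ∈ Set.Icc (massOne H) (pBar H) ∧ rateExt H α = ENNReal.log (ENNReal.ofReal x)⁻¹

/-- `α_I(x)`: the solution `α` in `[H({1}), pBar H]` of `I(α) = log (1/x)`, for `x_* ≤ x ≤ 1`. -/
def alphaI (H : Measure unitInterval) (x : ℝ) : ℝ :=
  Classical.epsilon fun α : ℝ => SolvesRate H x α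

/-- The distribution function of the limit law on `[0,1]`. When `H({1}) = 0` it is `0` on
`[0, x_*]` and `α_I` on `(x_*, 1)`. -/
def limitCDF (H : Measure unitInterval) (x : ℝ) : ℝ :=
  if x ≤ xStar H then massOne H else if x < 1 then alphaI H x else 1

end FragErasure

end

noncomputable section

namespace FragErasure

/-! Given the proportions, `A_{n,k}` is the probability that `S_n < k`, where `S_n` is a sum of
independent Bernoulli variables with parameters `P_1, …, P_n` (`breakPoint_stratified`). So
`A_{n,⌈un⌉}^{1/n}` obeys a Cramér theorem with frozen parameters. Chernoff's bound
(`rootBreakPoint_le`) and exponential tilting with Chebyshev's inequality (`le_rootBreakPoint`)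
enclose it between expressions in empirical averages, which converge almost surely, for all rational
tilts at once, by the strong law. The limit is `0` for `u < h`, `e^{-I(u)}` for `h < u < p̄` and `1`
for `u > p̄`.

This limit is the quantile function of the limit law. Since `G̃_n` is the image of Lebesgue measure
on `(0,1]` under `u ↦ A_{n,⌈un⌉}^{1/n}`, convergence for almost every `u` gives weak convergence by
dominated convergence.

`I` is a Legendre transform. Its regularity and monotonicity come, without differentiation, from the
supporting line inequality `tiltedMean_mul_le` and its strict form `tiltedMean_mul_lt`. -/

/-- The moment generating function `1 - t + t e^θ` of the Bernoulli law with success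
probability `t`. -/
def bernMgf (θ t : ℝ) : ℝ := 1 - t + t * Real.exp θ

/-- The success probability of the Bernoulli law obtained by exponential tilting. -/
def tiltProb (θ t : ℝ) : ℝ := t * Real.exp θ / bernMgf θ t

/-- The logarithmic moment generating function averaged over `H`. -/
def logMgf (H : Measure unitInterval) (θ : ℝ) : ℝ := ∫ t, Real.log (bernMgf θ t) ∂H

/-! ### Exponential tilting of one Bernoulli law. -/

section Pointwise

variable {t : ℝ}

theorem bernMgf_pos (ht : t ∈ Set.Icc (0 : ℝ) 1) (θ : ℝ) : 0 < bernMgf θ t := by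
  have h0 := ht.1
  have h1 := ht.2
  have he := Real.exp_pos θ
  unfold bernMgf
  rcases h1.lt_or_eq with h | h
  · have := mul_nonneg h0 he.le
    linarith
  · subst h
    linarith

theorem tiltProb_mem (ht : t ∈ Set.Icc (0 : ℝ) 1) (θ : ℝ) : tiltProb θ t ∈ Set.Icc (0 : ℝ) 1 := by
  have hp := bernMgf_pos ht θ
  refine ⟨div_nonneg (mul_nonneg ht.1 (Real.exp_pos θ).le) hp.le, ?_⟩
  rw [tiltProb, div_le_one hp, bernMgf]
  linarith [ht.2]

theorem tiltProb_mem_Ioo (ht : t ∈ Set.Ioo (0 : ℝ) 1) (θ : ℝ) :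
    tiltProb θ t ∈ Set.Ioo (0 : ℝ) 1 := by
  have hp := bernMgf_pos (Set.Ioo_subset_Icc_self ht) θ
  refine ⟨div_pos (mul_pos ht.1 (Real.exp_pos θ)) hp, ?_⟩
  rw [tiltProb, div_lt_one hp, bernMgf]
  linarith [ht.2]

theorem bernMgf_mul_tiltProb (ht : t ∈ Set.Icc (0 : ℝ) 1) (θ : ℝ) :
    bernMgf θ t * tiltProb θ t = t * Real.exp θ :=
  mul_div_cancel₀ _ (bernMgf_pos ht θ).ne'

theorem bernMgf_mul_one_sub_tiltProb (ht : t ∈ Set.Icc (0 : ℝ) 1) (θ : ℝ) :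
    bernMgf θ t * (1 - tiltProb θ t) = 1 - t := by
  rw [mul_sub, bernMgf_mul_tiltProb ht, bernMgf]
  ring

/-- Tilts compose: tilting by `η` and then by `θ - η` is tilting by `θ`. This reduces inequalities
at a general base point `η` to base point `0`. -/
theorem bernMgf_eq_mul (ht : t ∈ Set.Icc (0 : ℝ) 1) (θ η : ℝ) :
    bernMgf θ t = bernMgf η t * bernMgf (θ - η) (tiltProb η t) := by
  have h1 := bernMgf_mul_tiltProb ht η
  have h2 := bernMgf_mul_one_sub_tiltProb ht η
  have h3 : Real.exp θ = Real.exp η * Real.exp (θ - η) := by rw [← Real.exp_add]; ring_nf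
  calc bernMgf θ t = (1 - t) + (t * Real.exp η) * Real.exp (θ - η) := by
        rw [bernMgf, h3]; ring
    _ = bernMgf η t * bernMgf (θ - η) (tiltProb η t) := by
        rw [← h1, ← h2, bernMgf.eq_1 (θ - η)]; ring

/-- Concavity of `log` between `1` and `e^θ`, with weights `1 - t` and `t`. -/
theorem mul_le_log_bernMgf (ht : t ∈ Set.Icc (0 : ℝ) 1) (θ : ℝ) :
    t * θ ≤ Real.log (bernMgf θ t) := by
  have := strictConcaveOn_log_Ioi.concaveOn.2 (x := 1) (y := Real.exp θ) (by simp)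
    (Real.exp_pos θ) (sub_nonneg.2 ht.2) ht.1 (by ring)
  simpa [bernMgf] using this

theorem mul_lt_log_bernMgf (ht : t ∈ Set.Ioo (0 : ℝ) 1) {θ : ℝ} (hθ : θ ≠ 0) :
    t * θ < Real.log (bernMgf θ t) := by
  have := strictConcaveOn_log_Ioi.2 (x := 1) (y := Real.exp θ) (by simp)
    (Real.exp_pos θ) (fun h => hθ (Real.exp_eq_one_iff θ |>.1 h.symm)) (sub_pos.2 ht.2)
    ht.1 (by ring)
  simpa [bernMgf] using this

theorem log_bernMgf_sub (ht : t ∈ Set.Icc (0 : ℝ) 1) (θ η : ℝ) :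
    Real.log (bernMgf θ t) - Real.log (bernMgf η t)
      = Real.log (bernMgf (θ - η) (tiltProb η t)) := by
  rw [bernMgf_eq_mul ht θ η, Real.log_mul (bernMgf_pos ht η).ne'
    (bernMgf_pos (tiltProb_mem ht η) _).ne']
  ring

@[simp] theorem bernMgf_zero_left (t : ℝ) : bernMgf 0 t = 1 := by simp [bernMgf]

@[simp] theorem tiltProb_zero_left (t : ℝ) : tiltProb 0 t = t := by simp [tiltProb]

theorem log_bernMgf_le (ht : t ∈ Set.Icc (0 : ℝ) 1) (θ : ℝ) :
    Real.log (bernMgf θ t) ≤ tiltProb θ t * θ := by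
  have h := mul_le_log_bernMgf (tiltProb_mem ht θ) (0 - θ)
  rw [← log_bernMgf_sub ht] at h
  simp only [bernMgf_zero_left, Real.log_one] at h
  linarith

theorem abs_log_bernMgf_le (ht : t ∈ Set.Icc (0 : ℝ) 1) (θ : ℝ) :
    |Real.log (bernMgf θ t)| ≤ |θ| := by
  have h1 := mul_le_log_bernMgf ht θ
  have h2 := log_bernMgf_le ht θ
  have key : ∀ s ∈ Set.Icc (0 : ℝ) 1, |s * θ| ≤ |θ| := fun s hs => by
    rw [abs_mul, abs_of_nonneg hs.1]
    exact mul_le_of_le_one_left (abs_nonneg _) hs.2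
  have h3 := key t ht
  have h4 := key _ (tiltProb_mem ht θ)
  rw [abs_le] at *
  constructor <;> linarith

/-- A strong negative tilt kills every success that is not certain; this is why `H({1})` is the left
end point of the domain of `I`. -/
theorem tiltProb_tendsto_atBot (ht : t ∈ Set.Icc (0 : ℝ) 1) :
    Tendsto (fun θ => tiltProb θ t) atBot (𝓝 (if t = 1 then 1 else 0)) := by
  split_ifs with h
  · subst h
    simp [tiltProb, bernMgf]
  · have h1 : 1 - t ≠ 0 := sub_ne_zero.2 (Ne.symm h)
    have he := Real.tendsto_exp_atBot.const_mul t
    have hd : Tendsto (fun θ => 1 - t + t * Real.exp θ) atBot (𝓝 (1 - t + t * 0)) :=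
      he.const_add _
    have := he.div hd (by simpa using h1)
    rw [mul_zero, zero_div] at this
    exact this

theorem continuous_tiltProb_left (ht : t ∈ Set.Icc (0 : ℝ) 1) :
    Continuous fun θ => tiltProb θ t := by
  unfold tiltProb
  refine Continuous.div (by fun_prop) ?_ fun θ => (bernMgf_pos ht θ).ne'
  unfold bernMgf
  fun_prop

end Pointwise

theorem measurable_bernMgf (θ : ℝ) : Measurable (bernMgf θ) := by
  unfold bernMgf; fun_prop

theorem measurable_tiltProb (θ : ℝ) : Measurable (tiltProb θ) := by
  have := measurable_bernMgf θ
  unfold tiltProb; fun_prop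

theorem measurable_log_bernMgf (θ : ℝ) : Measurable fun t => Real.log (bernMgf θ t) :=
  Real.measurable_log.comp (measurable_bernMgf θ)

/-! ### Averages over `H`: bounds, continuity, convexity. -/

section Averaged

variable (H : Measure unitInterval)

theorem tiltedMean_eq (θ : ℝ) : tiltedMean H θ = ∫ t, tiltProb θ t ∂H := rfl

theorem rate_eq (α : ℝ) : rate H α = α * theta H α - logMgf H (theta H α) := rfl

@[simp] theorem tiltedMean_zero : tiltedMean H 0 = pBar H := by
  simp [tiltedMean_eq, pBar]

@[simp] theorem logMgf_zero : logMgf H 0 = 0 := by simp [logMgf]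

theorem massOne_nonneg : 0 ≤ massOne H := measureReal_nonneg

theorem integral_indicator_one :
    ∫ t : unitInterval, (if (t : ℝ) = 1 then (1 : ℝ) else 0) ∂H = massOne H := by
  have : (fun t : unitInterval => if (t : ℝ) = 1 then (1 : ℝ) else 0)
      = Set.indicator {1} (fun _ => (1 : ℝ)) := by
    ext t
    have h : t = 1 ↔ (t : ℝ) = 1 := Subtype.ext_iff
    simp only [Set.indicator_apply, Set.mem_singleton_iff, h]
  rw [this, integral_indicator (measurableSet_singleton 1)]
  simp [massOne, Measure.real]

theorem norm_tiltProb_le (θ : ℝ) (t : unitInterval) : ‖tiltProb θ t‖ ≤ 1 := by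
  have := tiltProb_mem t.2 θ
  rw [Real.norm_eq_abs, abs_of_nonneg this.1]
  exact this.2

variable [IsProbabilityMeasure H]

theorem integrable_tiltProb (θ : ℝ) : Integrable (fun t : unitInterval => tiltProb θ t) H :=
  Integrable.of_bound ((measurable_tiltProb θ).comp measurable_subtype_coe).aestronglyMeasurable 1
    (ae_of_all _ (norm_tiltProb_le θ))

theorem integrable_log_bernMgf (θ : ℝ) :
    Integrable (fun t : unitInterval => Real.log (bernMgf θ t)) H :=
  Integrable.of_bound
    ((measurable_log_bernMgf θ).comp measurable_subtype_coe).aestronglyMeasurable |θ|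
    (ae_of_all _ fun t => abs_log_bernMgf_le t.2 θ)

theorem integrable_coe : Integrable (fun t : unitInterval => (t : ℝ)) H := by
  simpa using integrable_tiltProb H 0

theorem tiltedMean_mem (θ : ℝ) : tiltedMean H θ ∈ Set.Icc (0 : ℝ) 1 := by
  refine ⟨integral_nonneg fun t => (tiltProb_mem t.2 θ).1, ?_⟩
  have := integral_mono (integrable_tiltProb H θ) (integrable_const (1 : ℝ))
    fun t => (tiltProb_mem t.2 θ).2
  simpa [tiltedMean_eq] using this

theorem continuous_tiltedMean : Continuous (tiltedMean H) :=
  continuous_of_dominated (F := fun θ (t : unitInterval) => tiltProb θ t)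
    (fun θ => (integrable_tiltProb H θ).aestronglyMeasurable)
    (fun θ => ae_of_all _ (norm_tiltProb_le θ)) (integrable_const 1)
    (ae_of_all _ fun t => continuous_tiltProb_left t.2)

theorem integrable_indicator_one :
    Integrable (fun t : unitInterval => if (t : ℝ) = 1 then (1 : ℝ) else 0) H := by
  refine Integrable.of_bound (Measurable.aestronglyMeasurable ?_) 1 (ae_of_all _ fun t => ?_)
  · exact Measurable.ite (measurableSet_eq_fun measurable_subtype_coe measurable_const)
      measurable_const measurable_const
  · split_ifs <;> simp

theorem tendsto_tiltedMean_atBot : Tendsto (tiltedMean H) atBot (𝓝 (massOne H)) := by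
  rw [← integral_indicator_one]
  exact tendsto_integral_filter_of_dominated_convergence
    (F := fun θ (t : unitInterval) => tiltProb θ t) (fun _ => 1)
    (Eventually.of_forall fun θ => (integrable_tiltProb H θ).aestronglyMeasurable)
    (Eventually.of_forall fun θ => ae_of_all _ (norm_tiltProb_le θ)) (integrable_const 1)
    (ae_of_all _ fun t => tiltProb_tendsto_atBot t.2)

/-- Supporting line of the convex function `logMgf H` at `η`, with `tiltedMean H η` in the role of
the derivative. -/
theorem tiltedMean_mul_le (θ η : ℝ) :
    tiltedMean H η * (θ - η) ≤ logMgf H θ - logMgf H η := by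
  rw [logMgf, logMgf, tiltedMean_eq, ← integral_mul_const,
    ← integral_sub (integrable_log_bernMgf H θ) (integrable_log_bernMgf H η)]
  refine integral_mono ((integrable_tiltProb H η).mul_const _)
    ((integrable_log_bernMgf H θ).sub (integrable_log_bernMgf H η)) fun t => ?_
  simp only [log_bernMgf_sub t.2 θ η]
  exact mul_le_log_bernMgf (tiltProb_mem t.2 η) _

theorem continuous_logMgf : Continuous (logMgf H) := by
  have : LipschitzWith 1 (logMgf H) := by
    refine LipschitzWith.of_le_add fun θ η => ?_
    have h := tiltedMean_mul_le H η θ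
    have hm := tiltedMean_mem H θ
    have h2 : |tiltedMean H θ * (θ - η)| ≤ |θ - η| := by
      rw [abs_mul, abs_of_nonneg hm.1]
      exact mul_le_of_le_one_left (abs_nonneg _) hm.2
    rw [Real.dist_eq]
    have := (abs_le.1 h2).2
    linarith
  exact this.continuous

/-- The atom at `1` contributes exactly `θ` per unit mass, and the rest is nonpositive. For `u < h`
this drives the Chernoff bound to `0` as `θ → -∞`. -/
theorem logMgf_le_massOne_mul {θ : ℝ} (hθ : θ ≤ 0) : logMgf H θ ≤ massOne H * θ := by
  rw [logMgf, ← integral_indicator_one, ← integral_mul_const]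
  refine integral_mono (integrable_log_bernMgf H θ) ((integrable_indicator_one H).mul_const θ)
    fun t => ?_
  dsimp only
  split_ifs with h
  · simp [h, bernMgf]
  · have := log_bernMgf_le t.2 θ
    have h2 := mul_nonpos_of_nonneg_of_nonpos (tiltProb_mem t.2 θ).1 hθ
    linarith

end Averaged

/-! ### Strict convexity and the rate function. -/

section Nondegenerate

variable {H : Measure unitInterval} [IsProbabilityMeasure H]

theorem mem_Ioo_of_mem_compl {t : unitInterval} (ht : t ∈ ({0, 1} : Set unitInterval)ᶜ) :
    (t : ℝ) ∈ Set.Ioo (0 : ℝ) 1 := by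
  simp only [Set.mem_compl_iff, Set.mem_insert_iff, Set.mem_singleton_iff, not_or] at ht
  exact ⟨unitInterval.pos_iff_ne_zero.2 ht.1, unitInterval.lt_one_iff_ne_one.2 ht.2⟩

/-- `H` charges the open interval, so strictness there suffices. All strictness in the proof
originates here. -/
theorem integral_lt_integral_of_nondegenerate (hH : H {0, 1} < 1) {f g : unitInterval → ℝ}
    (hf : Integrable f H) (hg : Integrable g H) (hfg : ∀ t, f t ≤ g t)
    (hlt : ∀ t : unitInterval, (t : ℝ) ∈ Set.Ioo (0 : ℝ) 1 → f t < g t) :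
    ∫ t, f t ∂H < ∫ t, g t ∂H := by
  have hm : MeasurableSet ({0, 1} : Set unitInterval) := (Set.toFinite _).measurableSet
  have hpos : 0 < H ({0, 1} : Set unitInterval)ᶜ := by
    rw [prob_compl_eq_one_sub hm]
    exact tsub_pos_of_lt hH
  have := (integral_pos_iff_support_of_nonneg (f := fun t => g t - f t)
    (fun t => sub_nonneg.2 (hfg t)) (hg.sub hf)).2
    (hpos.trans_le (measure_mono fun t ht => (sub_pos.2 (hlt t (mem_Ioo_of_mem_compl ht))).ne'))
  rw [integral_sub hg hf] at this
  linarith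

theorem massOne_lt_pBar (hH : H {0, 1} < 1) : massOne H < pBar H := by
  rw [← integral_indicator_one]
  refine integral_lt_integral_of_nondegenerate hH (integrable_indicator_one H)
    (integrable_coe H) (fun t => ?_) fun t ht => ?_
  · split_ifs with h
    · exact h.ge
    · exact t.2.1
  · simpa [ht.2.ne] using ht.1

theorem pBar_lt_one (hH : H {0, 1} < 1) : pBar H < 1 := by
  have := integral_lt_integral_of_nondegenerate hH (integrable_coe H) (integrable_const (1 : ℝ))
    (fun t => t.2.2) fun t ht => ht.2
  simpa [pBar] using this

theorem tiltedMean_mul_lt (hH : H {0, 1} < 1) {θ η : ℝ} (h : θ ≠ η) :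
    tiltedMean H η * (θ - η) < logMgf H θ - logMgf H η := by
  rw [logMgf, logMgf, tiltedMean_eq, ← integral_mul_const,
    ← integral_sub (integrable_log_bernMgf H θ) (integrable_log_bernMgf H η)]
  refine integral_lt_integral_of_nondegenerate hH ((integrable_tiltProb H η).mul_const _)
    ((integrable_log_bernMgf H θ).sub (integrable_log_bernMgf H η)) (fun t => ?_) fun t ht => ?_
  · rw [log_bernMgf_sub t.2 θ η]
    exact mul_le_log_bernMgf (tiltProb_mem t.2 η) _
  · rw [log_bernMgf_sub t.2 θ η]
    exact mul_lt_log_bernMgf (tiltProb_mem_Ioo ht η) (sub_ne_zero.2 h)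

/-- Add the strict supporting line inequalities based at the two points. -/
theorem strictMono_tiltedMean (hH : H {0, 1} < 1) : StrictMono (tiltedMean H) := by
  intro θ η h
  have h1 := tiltedMean_mul_lt hH h.ne
  have h2 := tiltedMean_mul_lt hH h.ne'
  have h3 : 0 < η - θ := sub_pos.2 h
  nlinarith

theorem existsUnique_tiltedMean (hH : H {0, 1} < 1) {α : ℝ}
    (hα : α ∈ Set.Ioc (massOne H) (pBar H)) : ∃! θ : ℝ, tiltedMean H θ = α := by
  obtain ⟨η, hη⟩ := ((tendsto_tiltedMean_atBot H).eventually_lt_const hα.1).exists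
  obtain ⟨θ, hθ⟩ := mem_range_of_exists_le_of_exists_ge (continuous_tiltedMean H)
    ⟨η, hη.le⟩ ⟨0, by simpa using hα.2⟩
  exact ⟨θ, hθ, fun θ' h => (strictMono_tiltedMean hH).injective (h.trans hθ.symm)⟩

theorem tiltedMean_theta (hH : H {0, 1} < 1) {α : ℝ}
    (hα : α ∈ Set.Ioc (massOne H) (pBar H)) : tiltedMean H (theta H α) = α :=
  Classical.epsilon_spec (existsUnique_tiltedMean hH hα).exists

theorem theta_nonpos (hH : H {0, 1} < 1) {α : ℝ}
    (hα : α ∈ Set.Ioc (massOne H) (pBar H)) : theta H α ≤ 0 := by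
  rw [← (strictMono_tiltedMean hH).le_iff_le, tiltedMean_theta hH hα]
  simpa using hα.2

theorem theta_pBar (hH : H {0, 1} < 1) : theta H (pBar H) = 0 :=
  (strictMono_tiltedMean hH).injective (by
    rw [tiltedMean_theta hH ⟨massOne_lt_pBar hH, le_rfl⟩, tiltedMean_zero])

theorem rate_pBar (hH : H {0, 1} < 1) : rate H (pBar H) = 0 := by
  simp [rate_eq, theta_pBar hH]

theorem theta_le_theta (hH : H {0, 1} < 1) {α β : ℝ} (hα : α ∈ Set.Ioc (massOne H) (pBar H))
    (hβ : β ∈ Set.Ioc (massOne H) (pBar H)) (h : α ≤ β) : theta H α ≤ theta H β := by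
  rwa [← (strictMono_tiltedMean hH).le_iff_le, tiltedMean_theta hH hα, tiltedMean_theta hH hβ]

/-- The supremum in the Legendre transform is attained at `theta H α`. -/
theorem le_rate (hH : H {0, 1} < 1) {α : ℝ} (hα : α ∈ Set.Ioc (massOne H) (pBar H)) (η : ℝ) :
    α * η - logMgf H η ≤ rate H α := by
  have := tiltedMean_mul_le H η (theta H α)
  rw [tiltedMean_theta hH hα] at this
  rw [rate_eq]
  linarith

theorem strictAntiOn_rate (hH : H {0, 1} < 1) :
    StrictAntiOn (rate H) (Set.Ioc (massOne H) (pBar H)) := by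
  intro α hα β hβ h
  have hne : theta H β ≠ theta H α := fun e => by
    have h1 := tiltedMean_theta hH hα
    have h2 := tiltedMean_theta hH hβ
    rw [e, h1] at h2
    exact h.ne h2
  have h1 := tiltedMean_mul_lt hH hne
  rw [tiltedMean_theta hH hα] at h1
  rw [rate_eq, rate_eq]
  nlinarith [theta_nonpos hH hβ]

/-- `theta H α` is a subgradient of the rate at `α`. -/
theorem rate_sub_le (hH : H {0, 1} < 1) {α β : ℝ} (hβ : β ∈ Set.Ioc (massOne H) (pBar H)) :
    rate H α - rate H β ≤ (α - β) * theta H α := by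
  have := le_rate hH hβ (theta H α)
  rw [rate_eq H α]
  linarith

theorem continuousOn_rate (hH : H {0, 1} < 1) :
    ContinuousOn (rate H) (Set.Ioc (massOne H) (pBar H)) := by
  intro α hα
  obtain ⟨γ, hγ1, hγ2⟩ := exists_between hα.1
  have hγ : γ ∈ Set.Ioc (massOne H) (pBar H) := ⟨hγ1, hγ2.le.trans hα.2⟩
  have hsub : ∀ x ∈ Set.Icc γ (pBar H), x ∈ Set.Ioc (massOne H) (pBar H) :=
    fun x hx => ⟨hγ1.trans_le hx.1, hx.2⟩
  -- On `[γ, p̄]` the subgradients lie between `theta H γ` and `0`, by monotonicity of `theta`.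
  have hL : LipschitzOnWith (Real.toNNReal (-theta H γ)) (rate H) (Set.Icc γ (pBar H)) := by
    refine LipschitzOnWith.of_le_add_mul _ fun x hx y hy => ?_
    have h0 := theta_nonpos hH hγ
    rw [Real.coe_toNNReal _ (by linarith)]
    have h1 := rate_sub_le hH (α := x) (hsub y hy)
    have h2 := theta_le_theta hH hγ (hsub x hx) hx.1
    have h3 := theta_nonpos hH (hsub x hx)
    have h4 : (x - y) * theta H x ≤ |x - y| * (-theta H x) := by
      rw [← abs_of_nonpos h3, ← abs_mul]
      exact le_abs_self _
    have h5 : |x - y| * (-theta H x) ≤ |x - y| * (-theta H γ) :=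
      mul_le_mul_of_nonneg_left (by linarith) (abs_nonneg _)
    rw [Real.dist_eq]
    linarith
  have hc := hL.continuousOn α ⟨hγ2.le, hα.2⟩
  refine hc.mono_of_mem_nhdsWithin ?_
  filter_upwards [mem_nhdsWithin_of_mem_nhds (Ioi_mem_nhds hγ2), self_mem_nhdsWithin]
    with x hx hx' using ⟨le_of_lt hx, hx'.2⟩

end Nondegenerate

/-! ### The solution `α_I` and the limit law. -/

section LimitLaw

variable {H : Measure unitInterval}

theorem rateExt_massOne : rateExt H (massOne H) = rateLeft H := if_pos rfl

theorem rateExt_of_mem {α : ℝ} (hα : α ∈ Set.Ioc (massOne H) (pBar H)) :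
    rateExt H α = rate H α := if_neg hα.1.ne'

theorem xStar_nonneg : 0 ≤ xStar H := ENNReal.toReal_nonneg

variable [IsProbabilityMeasure H]

theorem tendsto_rate_rateLeft (hH : H {0, 1} < 1) :
    Tendsto (fun α => (rate H α : EReal)) (𝓝[>] massOne H) (𝓝 (rateLeft H)) := by
  have hanti : AntitoneOn (fun α => (rate H α : EReal)) (Set.Ioo (massOne H) (pBar H)) :=
    fun x hx y hy h => EReal.coe_le_coe_iff.2 ((strictAntiOn_rate hH).antitoneOn
      (Set.Ioo_subset_Ioc_self hx) (Set.Ioo_subset_Ioc_self hy) h)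
  have := hanti.tendsto_nhdsWithin_Ioo_right (Set.nonempty_Ioo.2 (massOne_lt_pBar hH))
    (OrderTop.bddAbove _)
  rwa [rateLeft, this.limUnder_eq]

theorem rate_lt_rateLeft (hH : H {0, 1} < 1) {α : ℝ} (hα : α ∈ Set.Ioc (massOne H) (pBar H)) :
    (rate H α : EReal) < rateLeft H := by
  -- An intermediate point keeps the inequality strict when passing to the limit.
  obtain ⟨γ, h1, h2⟩ := exists_between hα.1
  have hγ : γ ∈ Set.Ioc (massOne H) (pBar H) := ⟨h1, h2.le.trans hα.2⟩
  refine (EReal.coe_lt_coe_iff.2 (strictAntiOn_rate hH hγ hα h2)).trans_le ?_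
  refine ge_of_tendsto (tendsto_rate_rateLeft hH) ?_
  filter_upwards [Ioo_mem_nhdsGT h1] with x hx
  exact EReal.coe_le_coe_iff.2
    ((strictAntiOn_rate hH).antitoneOn ⟨hx.1, hx.2.le.trans hγ.2⟩ hγ hx.2.le)

theorem rateLeft_pos (hH : H {0, 1} < 1) : 0 < rateLeft H := by
  simpa [rate_pBar hH] using rate_lt_rateLeft hH ⟨massOne_lt_pBar hH, le_rfl⟩

theorem strictAntiOn_rateExt (hH : H {0, 1} < 1) :
    StrictAntiOn (rateExt H) (Set.Icc (massOne H) (pBar H)) := by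
  intro α hα β hβ h
  have hβ' : β ∈ Set.Ioc (massOne H) (pBar H) := ⟨hα.1.trans_lt h, hβ.2⟩
  rw [rateExt_of_mem hβ']
  rcases hα.1.eq_or_lt with e | hlt
  · rw [← e, rateExt_massOne]
    exact rate_lt_rateLeft hH hβ'
  · rw [rateExt_of_mem ⟨hlt, hα.2⟩]
    exact EReal.coe_lt_coe_iff.2 (strictAntiOn_rate hH ⟨hlt, hα.2⟩ hβ' h)

theorem ofReal_xStar (hH : H {0, 1} < 1) :
    ENNReal.ofReal (xStar H) = EReal.exp (-rateLeft H) := by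
  refine ENNReal.ofReal_toReal fun h => ?_
  rw [EReal.exp_eq_top_iff, EReal.neg_eq_top_iff] at h
  have := rateLeft_pos hH
  simp [h] at this

theorem xStar_lt_iff (hH : H {0, 1} < 1) {x : ℝ} (hx : 0 < x) :
    xStar H < x ↔ ((-Real.log x : ℝ) : EReal) < rateLeft H := by
  rw [← ENNReal.ofReal_lt_ofReal_iff hx, ofReal_xStar hH, ← ENNReal.log_lt_log_iff, EReal.log_exp,
    ENNReal.log_ofReal_of_pos hx, EReal.coe_neg, EReal.neg_lt_comm]

theorem xStar_lt_one (hH : H {0, 1} < 1) : xStar H < 1 := by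
  rw [xStar_lt_iff hH one_pos]
  simpa using rateLeft_pos hH

theorem xStar_lt_exp_neg_rate (hH : H {0, 1} < 1) {α : ℝ}
    (hα : α ∈ Set.Ioc (massOne H) (pBar H)) : xStar H < Real.exp (-rate H α) := by
  rw [xStar_lt_iff hH (Real.exp_pos _)]
  simpa using rate_lt_rateLeft hH hα

theorem exists_rate_eq (hH : H {0, 1} < 1) {x : ℝ} (hx : xStar H < x) (hx1 : x ≤ 1) :
    ∃ α ∈ Set.Ioc (massOne H) (pBar H), rate H α = -Real.log x := by
  have hx0 : 0 < x := xStar_nonneg.trans_lt hx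
  obtain ⟨γ, hγ, hγ'⟩ := (((tendsto_rate_rateLeft hH).eventually_const_lt
    ((xStar_lt_iff hH hx0).1 hx)).and (Ioc_mem_nhdsGT (massOne_lt_pBar hH))).exists
  have hsub : Set.Icc γ (pBar H) ⊆ Set.Ioc (massOne H) (pBar H) :=
    fun y hy => ⟨hγ'.1.trans_le hy.1, hy.2⟩
  obtain ⟨α, hα, h⟩ := intermediate_value_Icc' hγ'.2 ((continuousOn_rate hH).mono hsub)
    ⟨(rate_pBar hH).trans_le (neg_nonneg.2 (Real.log_nonpos hx0.le hx1)),
      (EReal.coe_lt_coe_iff.1 hγ).le⟩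
  exact ⟨α, hsub hα, h⟩

theorem log_inv_ofReal {x : ℝ} (hx : 0 < x) :
    ENNReal.log (ENNReal.ofReal x)⁻¹ = ((-Real.log x : ℝ) : EReal) := by
  rw [ENNReal.log_inv, ENNReal.log_ofReal_of_pos hx, EReal.coe_neg]

theorem existsUnique_solvesRate (hH : H {0, 1} < 1) {x : ℝ} (hx : x ∈ Set.Icc (xStar H) 1) :
    ∃! α : ℝ, SolvesRate H x α := by
  refine existsUnique_of_exists_of_unique ?_ fun α β hα hβ =>
    (strictAntiOn_rateExt hH).injOn hα.1 hβ.1 (hα.2.trans hβ.2.symm)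
  -- At `x = x_*` the solution is the end point `h`; this includes `x_* = 0`, where both sides are
  -- `∞`.
  rcases hx.1.eq_or_lt with e | hlt
  · refine ⟨massOne H, ⟨le_rfl, (massOne_lt_pBar hH).le⟩, ?_⟩
    rw [rateExt_massOne, ← e, ofReal_xStar hH, ENNReal.log_inv, EReal.log_exp, neg_neg]
  · obtain ⟨α, hα, h⟩ := exists_rate_eq hH hlt hx.2
    refine ⟨α, Set.Ioc_subset_Icc_self hα, ?_⟩
    rw [rateExt_of_mem hα, log_inv_ofReal (xStar_nonneg.trans_lt hlt), h]

theorem alphaI_spec (hH : H {0, 1} < 1) {x : ℝ} (hx : xStar H < x) (hx1 : x ≤ 1) :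
    alphaI H x ∈ Set.Ioc (massOne H) (pBar H) ∧ rate H (alphaI H x) = -Real.log x := by
  obtain ⟨h1, h2⟩ : SolvesRate H x (alphaI H x) :=
    Classical.epsilon_spec (existsUnique_solvesRate hH ⟨hx.le, hx1⟩).exists
  have hx0 : 0 < x := xStar_nonneg.trans_lt hx
  rw [log_inv_ofReal hx0] at h2
  have hne : massOne H ≠ alphaI H x := fun e => by
    rw [← e, rateExt_massOne] at h2
    exact ((xStar_lt_iff hH hx0).1 hx).ne h2.symm
  have hmem : alphaI H x ∈ Set.Ioc (massOne H) (pBar H) := ⟨h1.1.lt_of_ne hne, h1.2⟩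
  rw [rateExt_of_mem hmem] at h2
  exact ⟨hmem, EReal.coe_eq_coe_iff.1 h2⟩

theorem limitCDF_mem (hH : H {0, 1} < 1) (x : ℝ) : limitCDF H x ∈ Set.Icc (0 : ℝ) 1 := by
  have h0 := massOne_nonneg H
  have h1 := massOne_lt_pBar hH
  have h2 := pBar_lt_one hH
  unfold limitCDF
  split_ifs with hx hx1
  · exact ⟨h0, by linarith⟩
  · have := (alphaI_spec hH (not_le.1 hx) hx1.le).1
    exact ⟨by linarith [this.1], by linarith [this.2]⟩
  · simp

variable (H) in
/-- The quantile function of the limit law. -/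
def limitQuantile (u : ℝ) : ℝ :=
  if u ≤ massOne H then 0 else if u ≤ pBar H then Real.exp (-rate H u) else 1

theorem rate_nonneg (hH : H {0, 1} < 1) {α : ℝ} (hα : α ∈ Set.Ioc (massOne H) (pBar H)) :
    0 ≤ rate H α := by
  have := (strictAntiOn_rate hH).antitoneOn hα ⟨massOne_lt_pBar hH, le_rfl⟩ hα.2
  rwa [rate_pBar hH] at this

theorem limitQuantile_mem (hH : H {0, 1} < 1) (u : ℝ) : limitQuantile H u ∈ Set.Icc (0 : ℝ) 1 := by
  unfold limitQuantile
  split_ifs with h1 h2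
  · simp
  · have := rate_nonneg hH ⟨not_le.1 h1, h2⟩
    exact ⟨(Real.exp_pos _).le, by simpa using this⟩
  · simp

/-- The two functions are generalized inverses because `I` is strictly decreasing. At `x = 1` this
fails for `u > 1`. -/
theorem limitQuantile_le_iff (hH : H {0, 1} < 1) {x : ℝ} (hx0 : 0 ≤ x) (hx1 : x < 1) (u : ℝ) :
    limitQuantile H u ≤ x ↔ u ≤ limitCDF H x := by
  have hlt := massOne_lt_pBar hH
  unfold limitQuantile limitCDF
  split_ifs with h1 h2 h3 h4 h5
  · exact iff_of_true hx0 h1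
  · exact iff_of_true hx0 (h1.trans (alphaI_spec hH (not_le.1 h2) hx1.le).1.1.le)
  · have := xStar_lt_exp_neg_rate hH ⟨not_le.1 h1, h3⟩
    exact iff_of_false (not_le.2 (h4.trans_lt this)) h1
  · obtain ⟨hα, hr⟩ := alphaI_spec hH (not_le.1 h4) hx1.le
    have hx : 0 < x := xStar_nonneg.trans_lt (not_le.1 h4)
    rw [← Real.le_log_iff_exp_le hx, neg_le, ← hr]
    exact (strictAntiOn_rate hH).le_iff_ge hα ⟨not_le.1 h1, h3⟩
  · exact iff_of_false (not_le.2 hx1) h1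
  · exact iff_of_false (not_le.2 hx1) fun h => h3
      (h.trans (alphaI_spec hH (not_le.1 ‹_›) hx1.le).1.2)

/-- The quantile function of the limit law, with values in the unit interval. -/
def limitPoint (hH : H {0, 1} < 1) (u : ℝ) : unitInterval :=
  ⟨limitQuantile H u, limitQuantile_mem hH u⟩

theorem limitPoint_preimage_Iic (hH : H {0, 1} < 1) {x : unitInterval} (hx : x ≠ 1) :
    limitPoint hH ⁻¹' Set.Iic x = Set.Iic (limitCDF H x) := by
  ext u
  exact limitQuantile_le_iff hH x.2.1 (unitInterval.lt_one_iff_ne_one.2 hx) u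

theorem limitPoint_preimage_Iic_one (hH : H {0, 1} < 1) :
    limitPoint hH ⁻¹' Set.Iic 1 = Set.univ :=
  Set.eq_univ_of_forall fun u => (limitPoint hH u).2.2

theorem measurable_limitPoint (hH : H {0, 1} < 1) : Measurable (limitPoint hH) := by
  refine measurable_of_Iic fun x => ?_
  by_cases hx : x = 1
  · rw [hx, limitPoint_preimage_Iic_one]
    exact MeasurableSet.univ
  · rw [limitPoint_preimage_Iic hH hx]
    exact measurableSet_Iic

/-- The limit law: the image of the uniform distribution under the quantile function. -/
def limitLaw (hH : H {0, 1} < 1) : ProbabilityMeasure unitInterval :=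
  ⟨(volume.restrict (Set.Ioc (0 : ℝ) 1)).map (limitPoint hH), by
    have : IsProbabilityMeasure (volume.restrict (Set.Ioc (0 : ℝ) 1)) := ⟨by simp⟩
    exact Measure.isProbabilityMeasure_map (measurable_limitPoint hH).aemeasurable⟩

theorem limitLaw_real_Iic (hH : H {0, 1} < 1) (x : unitInterval) :
    (limitLaw hH : Measure unitInterval).real (Set.Iic x) = limitCDF H x := by
  have hc := limitCDF_mem hH x
  change ((volume.restrict (Set.Ioc (0 : ℝ) 1)).map (limitPoint hH)).real (Set.Iic x) = _
  rw [map_measureReal_apply (measurable_limitPoint hH) measurableSet_Iic]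
  by_cases hx : x = 1
  · have : limitCDF H x = 1 := by
      simp [hx, limitCDF, not_le.2 (xStar_lt_one hH)]
    rw [this, hx, limitPoint_preimage_Iic_one]
    simp [Measure.real]
  · rw [limitPoint_preimage_Iic hH hx, measureReal_restrict_apply measurableSet_Iic,
      Set.inter_comm, Set.Ioc_inter_Iic, min_eq_right hc.2, Real.volume_real_Ioc_of_le hc.1,
      sub_zero]

end LimitLaw

/-! ### Bernoulli sums and their link with break points. -/

/-- The expectation of `f (S_n)`, where `S_n` is a sum of `n` independent Bernoulli variables with
success probabilities `a 0, …, a (n - 1)`. -/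
def bernExp (a : ℕ → ℝ) : ℕ → (ℕ → ℝ) → ℝ
  | 0, f => f 0
  | n + 1, f => (1 - a n) * bernExp a n f + a n * bernExp a n fun j => f (j + 1)

section BernExp

variable {a : ℕ → ℝ}

theorem bernExp_const (a : ℕ → ℝ) (c : ℝ) (n : ℕ) : bernExp a n (fun _ => c) = c := by
  induction n with
  | zero => rfl
  | succ n ih => simp only [bernExp, ih]; ring

theorem bernExp_congr {n : ℕ} {f g : ℕ → ℝ} (h : ∀ j ≤ n, f j = g j) :
    bernExp a n f = bernExp a n g := by
  induction n generalizing f g with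
  | zero => exact h 0 le_rfl
  | succ n ih =>
    simp only [bernExp]
    rw [ih fun j hj => h j (by omega), ih fun j hj => h (j + 1) (by omega)]

theorem bernExp_add (n : ℕ) (f g : ℕ → ℝ) :
    bernExp a n (fun j => f j + g j) = bernExp a n f + bernExp a n g := by
  induction n generalizing f g with
  | zero => rfl
  | succ n ih =>
    simp only [bernExp]
    rw [ih, ih]
    ring

theorem bernExp_const_mul (n : ℕ) (c : ℝ) (f : ℕ → ℝ) :
    bernExp a n (fun j => c * f j) = c * bernExp a n f := by
  induction n generalizing f with
  | zero => rfl
  | succ n ih =>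
    simp only [bernExp]
    rw [ih, ih]
    ring

theorem bernExp_mono (ha : ∀ i, a i ∈ Set.Icc (0 : ℝ) 1) (n : ℕ) {f g : ℕ → ℝ}
    (h : ∀ j, f j ≤ g j) : bernExp a n f ≤ bernExp a n g := by
  induction n generalizing f g with
  | zero => exact h 0
  | succ n ih =>
    exact add_le_add (mul_le_mul_of_nonneg_left (ih h) (sub_nonneg.2 (ha n).2))
      (mul_le_mul_of_nonneg_left (ih fun j => h (j + 1)) (ha n).1)

/-- Change of measure: an exponential weight on the sum tilts each summand separately. -/
theorem bernExp_exp_mul (ha : ∀ i, a i ∈ Set.Icc (0 : ℝ) 1) (θ : ℝ) (n : ℕ) (f : ℕ → ℝ) :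
    bernExp a n (fun j => Real.exp (θ * j) * f j)
      = (∏ i ∈ Finset.range n, bernMgf θ (a i)) * bernExp (fun i => tiltProb θ (a i)) n f := by
  induction n generalizing f with
  | zero => simp [bernExp]
  | succ n ih =>
    have h1 : (fun j : ℕ => Real.exp (θ * (j + 1 : ℕ)) * f (j + 1))
        = fun j : ℕ => Real.exp θ * (Real.exp (θ * j) * f (j + 1)) := by
      ext j
      rw [← mul_assoc, ← Real.exp_add]
      push_cast
      ring_nf
    simp only [bernExp]
    rw [h1, bernExp_const_mul, ih, ih fun j => f (j + 1), Finset.prod_range_succ,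
      ← bernMgf_mul_one_sub_tiltProb (ha n) θ, ← mul_assoc (a n),
      ← bernMgf_mul_tiltProb (ha n) θ]
    ring

theorem bernExp_sq_sub (a : ℕ → ℝ) (n : ℕ) (c : ℝ) :
    bernExp a n (fun j => ((j : ℝ) - c) ^ 2)
      = ∑ i ∈ Finset.range n, a i * (1 - a i) + (∑ i ∈ Finset.range n, a i - c) ^ 2 := by
  induction n generalizing c with
  | zero => simp [bernExp]
  | succ n ih =>
    have h1 : (fun j : ℕ => (((j + 1 : ℕ) : ℝ) - c) ^ 2)
        = fun j : ℕ => ((j : ℝ) - (c - 1)) ^ 2 := by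
      ext j
      push_cast
      ring
    simp only [bernExp]
    rw [h1, ih, ih, Finset.sum_range_succ, Finset.sum_range_succ]
    ring

/-- The break point recursion conditions the event `S_n < k` on the last Bernoulli variable. -/
theorem breakPoint_stratified (p : ℕ → unitInterval) (n k : ℕ) :
    breakPoint (stratified p) n k
      = bernExp (fun i => (p (i + 1) : ℝ)) n (fun j => if j < k then 1 else 0) := by
  induction n generalizing k with
  | zero => cases k <;> simp [breakPoint, bernExp]
  | succ n ih =>
    cases k with
    | zero => simpa [breakPoint] using (bernExp_const _ 0 (n + 1)).symm
    | succ k =>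
      rw [breakPoint]
      split_ifs with h
      · rw [ih, ih]
        simp only [bernExp, stratified, Nat.add_lt_add_iff_right]
        ring
      -- Here `k + 1 > n + 1`, so the event is certain, in agreement with the value `1`.
      · rw [bernExp_congr (g := fun _ => 1) fun j hj => if_pos (by omega), bernExp_const]

/-- Chebyshev's inequality for a sum of independent Bernoulli variables. -/
theorem one_sub_le_bernExp_abs_le (ha : ∀ i, a i ∈ Set.Icc (0 : ℝ) 1) (n : ℕ) {δ : ℝ}
    (hδ : 0 < δ) :
    1 - n / δ ^ 2 ≤
      bernExp a n (fun j => if |(j : ℝ) - ∑ i ∈ Finset.range n, a i| ≤ δ then 1 else 0) := by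
  have hv : ∑ i ∈ Finset.range n, a i * (1 - a i) ≤ n := by
    calc _ ≤ ∑ i ∈ Finset.range n, (1 : ℝ) := Finset.sum_le_sum fun i _ => by
          have := ha i
          nlinarith [this.1, this.2]
      _ = n := by simp
  -- The indicator of the window dominates the parabola `1 - (j - ∑ a_i)² / δ²`.
  have h := bernExp_mono (a := a) ha n
    (f := fun j => 1 + -(1 / δ ^ 2) * ((j : ℝ) - ∑ i ∈ Finset.range n, a i) ^ 2)
    (g := fun j => if |(j : ℝ) - ∑ i ∈ Finset.range n, a i| ≤ δ then 1 else 0) fun j => by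
      have hp : 0 < 1 / δ ^ 2 := by positivity
      split_ifs with hj
      · nlinarith [mul_nonneg hp.le (sq_nonneg ((j : ℝ) - ∑ i ∈ Finset.range n, a i))]
      · have h1 : δ ^ 2 ≤ ((j : ℝ) - ∑ i ∈ Finset.range n, a i) ^ 2 := by
          rw [← sq_abs ((j : ℝ) - _)]
          exact pow_le_pow_left₀ hδ.le (not_le.1 hj).le 2
        have h2 := mul_le_mul_of_nonneg_left h1 hp.le
        have h3 : 1 / δ ^ 2 * δ ^ 2 = 1 := by field_simp
        linarith
  rw [bernExp_add, bernExp_const, bernExp_const_mul, bernExp_sq_sub, sub_self] at h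
  refine le_trans ?_ h
  have : 1 / δ ^ 2 * ∑ i ∈ Finset.range n, a i * (1 - a i) ≤ 1 / δ ^ 2 * n :=
    mul_le_mul_of_nonneg_left hv (by positivity)
  have h4 : (n : ℝ) / δ ^ 2 = 1 / δ ^ 2 * n := by ring
  rw [h4]
  linarith

end BernExp

/-! ### Chernoff upper bound and tilted lower bound. -/

section BreakPointBounds

variable (p : ℕ → unitInterval)

/-- The empirical mean of `log (1 - p_i + p_i e^θ)`. -/
def empLogMgf (θ : ℝ) (n : ℕ) : ℝ :=
  (∑ i ∈ Finset.range n, Real.log (bernMgf θ (p (i + 1)))) / n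

/-- The empirical mean of the tilted success probabilities. -/
def empTiltedMean (θ : ℝ) (n : ℕ) : ℝ :=
  (∑ i ∈ Finset.range n, tiltProb θ (p (i + 1))) / n

theorem prod_bernMgf_eq (θ : ℝ) {n : ℕ} (hn : n ≠ 0) :
    ∏ i ∈ Finset.range n, bernMgf θ (p (i + 1)) = Real.exp (n * empLogMgf p θ n) := by
  have : (n : ℝ) ≠ 0 := by exact_mod_cast hn
  rw [empLogMgf, mul_div_cancel₀ _ this, Real.exp_sum]
  exact Finset.prod_congr rfl fun i _ => (Real.exp_log (bernMgf_pos (p (i + 1)).2 θ)).symm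

theorem exp_mul_rpow_inv (x : ℝ) {n : ℕ} (hn : n ≠ 0) :
    Real.exp (n * x) ^ (1 / (n : ℝ)) = Real.exp x := by
  have : (n : ℝ) ≠ 0 := by exact_mod_cast hn
  rw [← Real.exp_mul]
  congr 1
  field_simp

theorem rootBreakPoint_le {θ : ℝ} (hθ : θ ≤ 0) (u : ℝ) {n : ℕ} (hn : n ≠ 0) :
    (rootBreakPoint (stratified p) n ⌈u * n⌉₊ : ℝ)
      ≤ Real.exp (empLogMgf p θ n - u * θ) := by
  have h : breakPoint (stratified p) n ⌈u * n⌉₊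
      ≤ Real.exp (n * (empLogMgf p θ n - u * θ)) := by
    rw [breakPoint_stratified]
    -- Chernoff: since `θ ≤ 0`, the indicator of `j < un` is at most `e^{θ(j - un)}`.
    refine (bernExp_mono (fun i => (p (i + 1)).2) n
      (g := fun j => Real.exp (θ * j) * Real.exp (-(u * n) * θ)) fun j => ?_).trans_eq ?_
    · split_ifs with hj
      · rw [← Real.exp_add, Real.one_le_exp_iff]
        nlinarith [Nat.lt_ceil.1 hj]
      · positivity
    · rw [bernExp_exp_mul (fun i => (p (i + 1)).2), bernExp_const, prod_bernMgf_eq p θ hn,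
        ← Real.exp_add]
      congr 1
      ring
  rw [← exp_mul_rpow_inv _ hn]
  exact Real.rpow_le_rpow (breakPoint_mem _ _ _).1 h (by positivity)

theorem le_rootBreakPoint {θ : ℝ} (hθ : θ ≤ 0) {u δ : ℝ} (hδ : 0 < δ) {n : ℕ} (hn : n ≠ 0)
    (hnδ : 2 ≤ δ ^ 2 * n) (hu : empTiltedMean p θ n + δ < u) :
    Real.exp (empLogMgf p θ n - (empTiltedMean p θ n - δ) * θ - 1 / n)
      ≤ (rootBreakPoint (stratified p) n ⌈u * n⌉₊ : ℝ) := by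
  have hn0 : (0 : ℝ) < n := by exact_mod_cast Nat.pos_of_ne_zero hn
  set m := empTiltedMean p θ n with hm
  have hsum : ∑ i ∈ Finset.range n, tiltProb θ (p (i + 1)) = n * m := by
    rw [hm, empTiltedMean, mul_div_cancel₀ _ hn0.ne']
  have h : Real.exp (n * (empLogMgf p θ n - (m - δ) * θ - 1 / n))
      ≤ breakPoint (stratified p) n ⌈u * n⌉₊ := by
    rw [breakPoint_stratified]
    have hcheb := one_sub_le_bernExp_abs_le (fun i => tiltProb_mem (p (i + 1)).2 θ) n
      (mul_pos hδ hn0)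
    rw [hsum] at hcheb
    -- The window has tilted probability at least `1/2 > e^{-1}`; the factor `e^{-1}` becomes the
    -- `1/n` in the exponent after the `n`-th root.
    have hexp : Real.exp (-1) ≤ 1 - n / (δ * n) ^ 2 := by
      have h1 : (n : ℝ) / (δ * n) ^ 2 ≤ 1 / 2 := by
        rw [div_le_div_iff₀ (by positivity) two_pos]
        nlinarith
      have h2 := Real.exp_neg_one_lt_half
      linarith
    calc Real.exp (n * (empLogMgf p θ n - (m - δ) * θ - 1 / n))
        = Real.exp (-(n * (m - δ) * θ)) * (Real.exp (n * empLogMgf p θ n) * Real.exp (-1)) := by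
          rw [← Real.exp_add, ← Real.exp_add]
          congr 1
          field_simp
          ring
      _ ≤ Real.exp (-(n * (m - δ) * θ)) * (Real.exp (n * empLogMgf p θ n) *
            bernExp (fun i => tiltProb θ (p (i + 1))) n
              (fun j => if |(j : ℝ) - n * m| ≤ δ * n then 1 else 0)) := by
          have := hexp.trans hcheb
          gcongr
      _ = bernExp (fun i => (p (i + 1) : ℝ)) n (fun j => Real.exp (-(n * (m - δ) * θ)) *
            (Real.exp (θ * j) * if |(j : ℝ) - n * m| ≤ δ * n then 1 else 0)) := by
          rw [bernExp_const_mul, bernExp_exp_mul (fun i => (p (i + 1)).2), prod_bernMgf_eq p θ hn]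
      _ ≤ _ := bernExp_mono (fun i => (p (i + 1)).2) n fun j => by
          -- In the window, `j ≤ n(m + δ) < un` makes the event occur, and `j ≥ n(m - δ)` with `θ ≤
          -- 0` bounds the weight by `1`.
          by_cases hj : |(j : ℝ) - n * m| ≤ δ * n
          · have hj' := abs_le.1 hj
            have : j < ⌈u * n⌉₊ := Nat.lt_ceil.2 (by nlinarith [hj'.2])
            rw [if_pos hj, if_pos this, mul_one, ← Real.exp_add, Real.exp_le_one_iff]
            nlinarith [hj'.1]
          · rw [if_neg hj, mul_zero, mul_zero]
            split_ifs <;> norm_num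
  rw [← exp_mul_rpow_inv _ hn]
  exact Real.rpow_le_rpow (Real.exp_pos _).le h (by positivity)

end BreakPointBounds

/-! ### Convergence of the empirical quantiles. -/

section Quantiles

/-- The law of large numbers for the empirical tilted cumulants and means of `p`, at all rational
parameters. -/
def IsTypical (H : Measure unitInterval) (p : ℕ → unitInterval) : Prop :=
  ∀ r : ℚ, Tendsto (empLogMgf p r) atTop (𝓝 (logMgf H r)) ∧
    Tendsto (empTiltedMean p r) atTop (𝓝 (tiltedMean H r))

variable {H : Measure unitInterval} {p : ℕ → unitInterval}

theorem IsTypical.eventually_lt (hp : IsTypical H p) {r : ℚ} (hr : r ≤ 0) {u c : ℝ}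
    (hc : Real.exp (logMgf H r - u * r) < c) :
    ∀ᶠ n : ℕ in atTop, (rootBreakPoint (stratified p) n ⌈u * n⌉₊ : ℝ) < c := by
  have h := (Real.continuous_exp.tendsto _).comp ((hp r).1.sub_const (u * r))
  filter_upwards [h.eventually_lt_const hc, eventually_ne_atTop 0] with n hn hn0
  exact (rootBreakPoint_le p (by exact_mod_cast hr) u hn0).trans_lt hn

theorem IsTypical.eventually_gt (hp : IsTypical H p) {r : ℚ} (hr : r ≤ 0) {u c : ℝ}
    (hu : tiltedMean H r < u) (hc : c < Real.exp (logMgf H r - tiltedMean H r * r)) :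
    ∀ᶠ n : ℕ in atTop, c < (rootBreakPoint (stratified p) n ⌈u * n⌉₊ : ℝ) := by
  obtain ⟨δ, ⟨hδ1, hδ2⟩, hδ0⟩ : ∃ δ : ℝ, (c < Real.exp (logMgf H r - (tiltedMean H r - δ) * r)
      ∧ tiltedMean H r + δ < u) ∧ 0 < δ := by
    have h1 : Continuous fun δ : ℝ => Real.exp (logMgf H r - (tiltedMean H r - δ) * r) := by
      fun_prop
    have h2 : Continuous fun δ : ℝ => tiltedMean H r + δ := by fun_prop
    have e1 := (h1.tendsto 0).eventually_const_lt (u := c) (by simpa using hc)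
    have e2 := (h2.tendsto 0).eventually_lt_const (u := u) (by simpa using hu)
    exact (((e1.and e2).filter_mono nhdsWithin_le_nhds).and
      (self_mem_nhdsWithin (s := Set.Ioi (0 : ℝ)))).exists
  have h := (Real.continuous_exp.tendsto _).comp
    (((hp r).1.sub (((hp r).2.sub_const δ).mul_const (r : ℝ))).sub
      tendsto_one_div_atTop_nhds_zero_nat)
  rw [sub_zero] at h
  have hn2 : Tendsto (fun n : ℕ => δ ^ 2 * (n : ℝ)) atTop atTop :=
    tendsto_natCast_atTop_atTop.const_mul_atTop (by positivity)
  filter_upwards [h.eventually_const_lt hδ1, ((hp r).2.add_const δ).eventually_lt_const hδ2,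
    hn2.eventually_ge_atTop 2, eventually_ne_atTop 0] with n h1 h2 h3 h4
  exact h1.trans_le (le_rootBreakPoint p (by exact_mod_cast hr) hδ0 h4 h3 h2)

/-- Approximating `theta H u` from below keeps the rational tilt negative and its tilted mean
strictly below `u`. -/
theorem exists_rat_lt_of_eventually {P : ℝ → Prop} {x : ℝ} (h : ∀ᶠ y in 𝓝 x, P y) :
    ∃ q : ℚ, (q : ℝ) < x ∧ P q := by
  obtain ⟨l, hl, hP⟩ := mem_nhdsLT_iff_exists_Ioo_subset.1 (h.filter_mono nhdsWithin_le_nhds)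
  obtain ⟨q, hq1, hq2⟩ := exists_rat_btwn (Set.mem_Iio.1 hl)
  exact ⟨q, hq2, hP ⟨hq1, hq2⟩⟩

variable [IsProbabilityMeasure H]

theorem theta_neg (hH : H {0, 1} < 1) {α : ℝ} (hα : α ∈ Set.Ioo (massOne H) (pBar H)) :
    theta H α < 0 := by
  rw [← (strictMono_tiltedMean hH).lt_iff_lt, tiltedMean_theta hH (Set.Ioo_subset_Ioc_self hα)]
  simpa using hα.2

theorem IsTypical.tendsto_rootBreakPoint (hp : IsTypical H p) (hH : H {0, 1} < 1) {u : ℝ}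
    (hu1 : u ≠ massOne H) (hu2 : u ≠ pBar H) :
    Tendsto (fun n : ℕ => (rootBreakPoint (stratified p) n ⌈u * n⌉₊ : ℝ)) atTop
      (𝓝 (limitQuantile H u)) := by
  have hc1 := continuous_logMgf H
  have hc2 := continuous_tiltedMean H
  rw [tendsto_order]
  rcases hu1.lt_or_gt with h | h
  · rw [limitQuantile, if_pos h.le]
    refine ⟨fun c hc => Eventually.of_forall fun n => hc.trans_le (rootBreakPoint _ n _).2.1,
      fun c hc => ?_⟩
    -- This choice gives `(h - u) r < log c`.
    obtain ⟨r, hr⟩ := exists_rat_lt (min 0 (Real.log c / (massOne H - u)))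
    obtain ⟨hr0, hr1⟩ := lt_min_iff.1 hr
    rw [lt_div_iff₀ (sub_pos.2 h)] at hr1
    refine hp.eventually_lt (r := r) (by exact_mod_cast hr0.le) ?_
    rw [← Real.lt_log_iff_exp_lt hc]
    have := logMgf_le_massOne_mul H hr0.le
    linarith
  rcases hu2.lt_or_gt with h' | h'
  · have hu : u ∈ Set.Ioc (massOne H) (pBar H) := ⟨h, h'.le⟩
    have hθ := theta_neg hH ⟨h, h'⟩
    have hm := tiltedMean_theta hH hu
    rw [limitQuantile, if_neg (not_le.2 h), if_pos h'.le]
    have hrate : -rate H u = logMgf H (theta H u) - u * theta H u := by rw [rate_eq]; ring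
    rw [hrate]
    constructor
    · intro c hc
      have hcont : Continuous fun θ => Real.exp (logMgf H θ - tiltedMean H θ * θ) := by fun_prop
      obtain ⟨r, hr, hrc⟩ := exists_rat_lt_of_eventually
        ((hcont.tendsto (theta H u)).eventually_const_lt (u := c) (by rwa [hm]))
      refine hp.eventually_gt (r := r) (by exact_mod_cast (hr.trans hθ).le) ?_ hrc
      exact (strictMono_tiltedMean hH hr).trans_eq hm
    · intro c hc
      have hcont : Continuous fun θ => Real.exp (logMgf H θ - u * θ) := by fun_prop
      obtain ⟨r, hr, hrc⟩ := exists_rat_lt_of_eventually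
        ((hcont.tendsto (theta H u)).eventually_lt_const hc)
      exact hp.eventually_lt (r := r) (by exact_mod_cast (hr.trans hθ).le) hrc
  · rw [limitQuantile, if_neg (not_le.2 h), if_neg (not_le.2 h')]
    -- Above the mean no tilt is needed: at `r = 0` the lower bound tends to `1`.
    refine ⟨fun c hc => hp.eventually_gt (r := 0) le_rfl (by simpa using h') (by simpa using hc),
      fun c hc => Eventually.of_forall fun n => (rootBreakPoint _ n _).2.2.trans_lt hc⟩

end Quantiles

/-! ### From quantiles to weak convergence. -/

section WeakConvergence

/-- `⌈un⌉` equals `k + 1` on `(k/n, (k+1)/n]`, so a uniform `u` selects each of the `n` atoms with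
probability `1/n`. -/
theorem integral_gTilde (p : ℕ → ℕ → unitInterval) {n : ℕ} (hn : n ≠ 0)
    (f : BoundedContinuousFunction unitInterval ℝ) :
    ∫ x, f x ∂(gTilde p n : Measure unitInterval)
      = ∫ u in (0 : ℝ)..1, f (rootBreakPoint p n ⌈u * n⌉₊) := by
  have hn0 : (0 : ℝ) < n := by exact_mod_cast Nat.pos_of_ne_zero hn
  have hpiece : ∀ k : ℕ, Set.EqOn (fun u : ℝ => f (rootBreakPoint p n ⌈u * n⌉₊))
      (fun _ => f (rootBreakPoint p n (k + 1)))
      (Set.Ioc ((k : ℝ) / n) (((k + 1 : ℕ) : ℝ) / n)) := fun k u hu => by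
    have h1 := (div_lt_iff₀ hn0).1 hu.1
    have h2 := (le_div_iff₀ hn0).1 hu.2
    have : ⌈u * n⌉₊ = k + 1 := by
      rw [Nat.ceil_eq_iff (by omega)]
      exact ⟨by simpa using h1, h2⟩
    simp only [this]
  have hle : ∀ k : ℕ, (k : ℝ) / n ≤ ((k + 1 : ℕ) : ℝ) / n := fun k => by
    gcongr
    omega
  have hadj := intervalIntegral.sum_integral_adjacent_intervals (μ := volume)
    (f := fun u : ℝ => f (rootBreakPoint p n ⌈u * n⌉₊)) (a := fun k => (k : ℝ) / n) (n := n)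
    fun k _ => by
      rw [intervalIntegrable_iff_integrableOn_Ioc_of_le (hle k)]
      exact (integrableOn_congr_fun (hpiece k) measurableSet_Ioc).2
        (integrableOn_const (by simp))
  have hval : ∀ k : ℕ, ∫ u in ((k : ℝ) / n)..(((k + 1 : ℕ) : ℝ) / n),
      f (rootBreakPoint p n ⌈u * n⌉₊) = (n : ℝ)⁻¹ * f (rootBreakPoint p n (k + 1)) := fun k => by
    rw [intervalIntegral.integral_of_le (hle k),
      setIntegral_congr_fun measurableSet_Ioc (hpiece k),
      ← intervalIntegral.integral_of_le (hle k), intervalIntegral.integral_const, smul_eq_mul]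
    congr 1
    push_cast
    field_simp
    ring
  rw [Finset.sum_congr rfl fun k _ => hval k, ← Finset.mul_sum, Nat.cast_zero, zero_div,
    div_self hn0.ne'] at hadj
  rw [← hadj]
  change ∫ x, f x ∂(gTildeMeasure p n) = _
  rw [gTildeMeasure, integral_smul_measure, integral_finsetSum_measure fun k _ =>
    f.integrable _]
  simp only [integral_dirac, ENNReal.toReal_inv, ENNReal.toReal_natCast, smul_eq_mul]
  rw [Finset.range_eq_Ico, Finset.sum_Ico_add' (fun k => f (rootBreakPoint p n k)) 0 n 1]
  rfl

theorem IsTypical.tendsto_gTilde {H : Measure unitInterval} [IsProbabilityMeasure H]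
    {p : ℕ → unitInterval} (hp : IsTypical H p) (hH : H {0, 1} < 1) :
    Tendsto (fun n : ℕ => gTilde (stratified p) n) atTop (𝓝 (limitLaw hH).toFiniteMeasure) := by
  rw [FiniteMeasure.tendsto_iff_forall_integral_tendsto]
  intro f
  have hlim : ∫ x, f x ∂((limitLaw hH).toFiniteMeasure : Measure unitInterval)
      = ∫ u in (0 : ℝ)..1, f (limitPoint hH u) := by
    rw [intervalIntegral.integral_of_le zero_le_one]
    exact integral_map (measurable_limitPoint hH).aemeasurable
      f.continuous.aestronglyMeasurable
  rw [hlim]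
  refine Tendsto.congr' (f₁ := fun n : ℕ => ∫ u in (0 : ℝ)..1,
    f (rootBreakPoint (stratified p) n ⌈u * n⌉₊)) ?_ ?_
  · filter_upwards [eventually_ne_atTop 0] with n hn using (integral_gTilde _ hn f).symm
  refine intervalIntegral.tendsto_integral_filter_of_dominated_convergence (fun _ => ‖f‖)
    (Eventually.of_forall fun n => ?_)
    (Eventually.of_forall fun n => ae_of_all _ fun u _ => f.norm_coe_le_norm _)
    intervalIntegrable_const ?_
  · have h1 : Measurable fun u : ℝ => ⌈u * n⌉₊ :=
      Nat.measurable_ceil.comp (measurable_id.mul_const (n : ℝ))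
    have h2 : Measurable fun k : ℕ => f (rootBreakPoint (stratified p) n k) :=
      measurable_from_top
    exact (h2.comp h1).aestronglyMeasurable
  -- The two exceptional levels `h` and `p̄` form a null set.
  · have hne : ∀ c : ℝ, ∀ᵐ u : ℝ, u ≠ c := fun c => by simp [ae_iff]
    filter_upwards [hne (massOne H), hne (pBar H)] with u h1 h2 _
    refine (f.continuous.tendsto _).comp ?_
    exact tendsto_subtype_rng.2 (hp.tendsto_rootBreakPoint hH h1 h2)

end WeakConvergence

/-! ### The strong law of large numbers at rational tilts. -/

section AlmostSure

variable {Ω : Type*} [MeasurableSpace Ω] {μ : Measure Ω} {P : ℕ → Ω → unitInterval}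

theorem ae_tendsto_average (hmeas : ∀ n, 1 ≤ n → Measurable (P n))
    (hindep : iIndepFun (fun n : ℕ => P (n + 1)) μ)
    (hident : ∀ n, 1 ≤ n → IdentDistrib (P n) (P 1) μ μ) {F : unitInterval → ℝ}
    (hF : Measurable F) (hint : Integrable F (μ.map (P 1))) :
    ∀ᵐ ω ∂μ, Tendsto (fun n : ℕ => (∑ i ∈ Finset.range n, F (P (i + 1) ω)) / n) atTop
      (𝓝 (∫ t, F t ∂μ.map (P 1))) := by
  have hm := hmeas 1 le_rfl
  rw [integral_map hm.aemeasurable hF.aestronglyMeasurable]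
  exact strong_law_ae_real (fun i ω => F (P (i + 1) ω)) (hint.comp_measurable hm)
    (fun i j hij => (hindep.indepFun hij).comp hF hF)
    fun i => (hident (i + 1) (by omega)).comp hF

theorem ae_isTypical [IsProbabilityMeasure μ] (hmeas : ∀ n, 1 ≤ n → Measurable (P n))
    (hindep : iIndepFun (fun n : ℕ => P (n + 1)) μ)
    (hident : ∀ n, 1 ≤ n → IdentDistrib (P n) (P 1) μ μ) :
    ∀ᵐ ω ∂μ, IsTypical (μ.map (P 1)) fun n => P n ω := by
  have : IsProbabilityMeasure (μ.map (P 1)) :=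
    Measure.isProbabilityMeasure_map (hmeas 1 le_rfl).aemeasurable
  -- Countability of the rational tilts gives one common null set.
  refine ae_all_iff.2 fun r => ?_
  filter_upwards [
    ae_tendsto_average hmeas hindep hident
      ((measurable_log_bernMgf r).comp measurable_subtype_coe) (integrable_log_bernMgf _ r),
    ae_tendsto_average hmeas hindep hident
      ((measurable_tiltProb r).comp measurable_subtype_coe) (integrable_tiltProb _ r)]
    with ω h1 h2 using ⟨h1, h2⟩

end AlmostSure

end FragErasure

end

theorem mainTheorem7 {Ω : Type*} [MeasurableSpace Ω] (μ : Measure Ω) [IsProbabilityMeasure μ]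
    -- `P 0` is not used: the splitting proportions are `P 1, P 2, …`
    (P : ℕ → Ω → unitInterval)
    (hmeas : ∀ n, 1 ≤ n → Measurable (P n))
    (hindep : iIndepFun (fun n : ℕ => P (n + 1)) μ)
    (hident : ∀ n, 1 ≤ n → IdentDistrib (P n) (P 1) μ μ)
    (H : Measure unitInterval) (hlaw : H = μ.map (P 1))
    (hH : H {0, 1} < 1) :
    -- the objects that define the limit law are well defined
    (FragErasure.massOne H < FragErasure.pBar H ∧ FragErasure.pBar H < 1) ∧
    (∀ α ∈ Set.Ioc (FragErasure.massOne H) (FragErasure.pBar H),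
      ∃! θ : ℝ, FragErasure.tiltedMean H θ = α) ∧
    ContinuousOn (FragErasure.rate H)
      (Set.Ioc (FragErasure.massOne H) (FragErasure.pBar H)) ∧
    StrictAntiOn (FragErasure.rate H)
      (Set.Ioc (FragErasure.massOne H) (FragErasure.pBar H)) ∧
    FragErasure.rate H (FragErasure.pBar H) = 0 ∧
    Tendsto (fun α => (FragErasure.rate H α : EReal)) (𝓝[>] FragErasure.massOne H)
      (𝓝 (FragErasure.rateLeft H)) ∧
    (∀ x ∈ Set.Icc (FragErasure.xStar H) 1, ∃! α : ℝ, FragErasure.SolvesRate H x α) ∧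
    -- the limit law exists, and the transformed empirical distributions converge weakly to it
    ∃ g : ProbabilityMeasure unitInterval,
      (∀ x : unitInterval, (g : Measure unitInterval).real (Set.Iic x)
        = FragErasure.limitCDF H (x : ℝ)) ∧
      ∀ᵐ ω ∂μ, Tendsto
        (fun n : ℕ => FragErasure.gTilde (FragErasure.stratified fun m => P m ω) n)
        atTop (𝓝 g.toFiniteMeasure) := by
  subst hlaw
  have : IsProbabilityMeasure (μ.map (P 1)) :=
    Measure.isProbabilityMeasure_map (hmeas 1 le_rfl).aemeasurable
  refine ⟨⟨FragErasure.massOne_lt_pBar hH, FragErasure.pBar_lt_one hH⟩,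
    fun α hα => FragErasure.existsUnique_tiltedMean hH hα, FragErasure.continuousOn_rate hH,
    FragErasure.strictAntiOn_rate hH, FragErasure.rate_pBar hH,
    FragErasure.tendsto_rate_rateLeft hH, fun x hx => FragErasure.existsUnique_solvesRate hH hx,
    FragErasure.limitLaw hH, FragErasure.limitLaw_real_Iic hH, ?_⟩
  filter_upwards [FragErasure.ae_isTypical hmeas hindep hident] with ω hω
  exact hω.tendsto_gTilde hH
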